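/- For an integer $k\ge 1$ and positive even integers $i_1,\dots,i_k$ the series \[ \zeta(i_1,\dots,i_k)=\sum_{n_1>\dots>n_k\ge 1}\frac1{n_1^{i_1}\cdots n_k^{i_k}} \] converges. For $n\ge k\ge 1$ let $E(2n,k)$ be the sum of $\zeta(i_1,\dots,i_k)$ over all $k$-tuples $(i_1,\dots,i_k)$ of positive even integers with $i_1+\dots+i_k=2n$. Then the generating function \[ F(t,s)=1+\sum_{n\ge k\ge 1}E(2n,k)\,t^n s^k \] satisfies \[ F(t,s)=\frac{\sin\bigl(\pi\sqrt{1-s}\,\sqrt{t}\bigr)}{\sqrt{1-s}\,\sin\bigl(\pi\sqrt{t}\bigr)} \] in both of the following senses. (a) As formal power series: let $\sqrt{1-s}=\sum_{m\ge 0}\binom{1/2}{m}(-s)^m\in\mathbb{R}[[s]]$ and write $t=u^2$, $\sqrt t=u$. In the integral domain $\mathbb{R}[[s]][[u]]$ we have $\sqrt{1-s}\,\sin(\pi u)\ne 0$ and $F(u^2,s)\cdot\sqrt{1-s}\,\sin(\pi u)=\sin(\pi\sqrt{1-s}\,u)$. (b) As functions: for all complex $t,s$ with $|t|<1$ the double series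 defining $F(t,s)$ converges absolutely, and if moreover $t\ne 0$ and $s\ne 1$, then for every choice of the complex square roots $\sqrt t$ and $\sqrt{1-s}$ the denominator $\sqrt{1-s}\,\sin(\pi\sqrt t)$ is nonzero and the displayed identity holds. -/

import Mathlib

open PowerSeries

/-- The index set of the multiple zeta series: `n₁ > n₂ > ⋯ > n_k ≥ 1`. -/
def MZVIndex (k : ℕ) : Type :=
  {n : Fin k → ℕ // StrictAnti n ∧ ∀ j, 1 ≤ n j}

/-- The general term `1 / (n₁ ^ i₁ ⋯ n_k ^ i_k)` of the multiple zeta series. -/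
noncomputable def mzvTerm {k : ℕ} (i : Fin k → ℕ) (n : MZVIndex k) : ℝ :=
  1 / ∏ j, (n.1 j : ℝ) ^ i j

/-- The multiple zeta value `ζ(i₁, …, i_k)`. -/
noncomputable def mzv {k : ℕ} (i : Fin k → ℕ) : ℝ :=
  ∑' n : MZVIndex k, mzvTerm i n

/-- The `k`-tuples of positive even integers with sum `w`. -/
def evenArguments (w k : ℕ) : Finset (Fin k → ℕ) :=
  {i ∈ Finset.piAntidiag Finset.univ w | ∀ j, 0 < i j ∧ Even (i j)}

/-- `E(w, k)`: the sum of all multiple zeta values of even arguments, weight `w` and depth `k`. -/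
noncomputable def evenMZVSum (w k : ℕ) : ℝ :=
  ∑ i ∈ evenArguments w k, mzv i

/-- The pairs `(n, k)` with `n ≥ k ≥ 1`. -/
def GenIndex : Type := {p : ℕ × ℕ // 1 ≤ p.2 ∧ p.2 ≤ p.1}

/-- The term `E(2n, k) tⁿ sᵏ` of the generating function at complex numbers `t`, `s`. -/
noncomputable def genTerm (t s : ℂ) (p : GenIndex) : ℂ :=
  (evenMZVSum (2 * p.1.1) p.1.2 : ℂ) * t ^ p.1.1 * s ^ p.1.2

/-- The value `F(t, s) = 1 + ∑_{n ≥ k ≥ 1} E(2n, k) tⁿ sᵏ` at complex numbers `t`, `s`. -/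
noncomputable def genFun (t s : ℂ) : ℂ := 1 + ∑' p : GenIndex, genTerm t s p

/-- The formal series `F(t, s) = 1 + ∑_{n ≥ k ≥ 1} E(2n, k) tⁿ sᵏ` in `ℝ⟦s⟧⟦t⟧`:
the outer variable is `t`, the inner one is `s`. -/
noncomputable def genSeries : ℝ⟦X⟧⟦X⟧ :=
  1 + PowerSeries.mk fun n => PowerSeries.mk fun k =>
    if 1 ≤ k ∧ k ≤ n then evenMZVSum (2 * n) k else 0

/-- The formal series `√(1 - s) = ∑ₘ (1/2 choose m) (-s)ᵐ` in `ℝ⟦s⟧`. -/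
noncomputable def sqrtOneSub : ℝ⟦X⟧ :=
  rescale (-1 : ℝ) (PowerSeries.binomialSeries ℝ (1 / 2 : ℝ))

theorem sqrtOneSub_sq : sqrtOneSub ^ 2 = 1 - X := by
  have h : PowerSeries.binomialSeries ℝ (1 / 2 : ℝ) ^ 2 = 1 + X := by
    rw [sq, ← binomialSeries_add]
    have := binomialSeries_nat (R := ℝ) (A := ℝ) 1
    norm_num at this ⊢
    exact this
  rw [sqrtOneSub, ← map_pow, h, map_add, map_one, rescale_X]
  simp [sub_eq_add_neg]

/-- The formal series `sin (π c u)` in `ℝ⟦s⟧⟦u⟧`, for `c` in `ℝ⟦s⟧`. -/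
noncomputable def sinPiMul (c : ℝ⟦X⟧) : ℝ⟦X⟧⟦X⟧ :=
  rescale (C Real.pi * c) (PowerSeries.sin ℝ⟦X⟧)

/-! ### Finite products of absolutely convergent series -/

section ProductOfSeries

/-! Put x_m = t/m². Expanding ∏_m (1 + s(x_m + x_m² + ⋯)) means choosing a finite set {n₁ > ⋯ > n_k}
and an exponent for each element, so the product is F(t,s). Summing the geometric series turns each
factor into (1 - (1-s)x_m)/(1 - x_m). Euler's product S(z) = sin(π√z)/√z = π∏(1 - z/m²) then gives
F(t,s)·S(t) = S((1-s)t), an identity free of square roots (`genFun_mul_sinSqrtDiv`).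

For |t| < 1 the full expansion converges absolutely (`summable_norm_expansionTerm`). Summing
exponents first gives the product (`hasSum_expansionTerm`); summing the n's first and grouping by
weight and depth gives F (`hasSum_evenMZVSum`).

The formal identity follows by comparing coefficients of t^m at each real s: both sides are
polynomials in s (`sum_antidiagonal_genPolynomial`). Substituting t = u² and multiplying by u√(1-s)
restores the sines. -/

theorem hasSum_prod_fin_of_summable_norm {R ι : Type*} [NormedCommRing R] [CompleteSpace R] :
    ∀ {k : ℕ} {f : Fin k → ι → R}, (∀ i, Summable fun j => ‖f i j‖) →
      (Summable fun j : Fin k → ι => ‖∏ i, f i (j i)‖) ∧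
        HasSum (fun j : Fin k → ι => ∏ i, f i (j i)) (∏ i, ∑' j, f i j) := by
  intro k
  induction k with
  | zero =>
    intro f _
    refine ⟨(hasSum_fintype _).summable, ?_⟩
    simp only [Finset.univ_eq_empty, Finset.prod_empty]
    exact hasSum_unique fun _ : Fin 0 → ι => (1 : R)
  | succ k ih =>
    intro f hf
    obtain ⟨h1, h2⟩ := ih (f := fun i => f i.succ) fun i => hf i.succ
    have key : ∀ p : ι × (Fin k → ι), ∏ i, f i (Fin.consEquiv (fun _ => ι) p i) =
        f 0 p.1 * ∏ i : Fin k, f i.succ (p.2 i) := by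
      intro p
      simp [Fin.prod_univ_succ, Fin.consEquiv]
    have h3 : Summable fun p : ι × (Fin k → ι) => ‖f 0 p.1 * ∏ i : Fin k, f i.succ (p.2 i)‖ :=
      Summable.mul_norm (f := f 0) (g := fun j : Fin k → ι => ∏ i : Fin k, f i.succ (j i)) (hf 0) h1
    have h4 : HasSum (f 0) (∑' j, f 0 j) := (hf 0).of_norm.hasSum
    have h5 : HasSum (fun p : ι × (Fin k → ι) => f 0 p.1 * ∏ i : Fin k, f i.succ (p.2 i))
        ((∑' j, f 0 j) * ∏ i : Fin k, ∑' j, f i.succ j) := by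
      have h6 := h3.of_norm
      obtain ⟨u, hu⟩ := h6
      have h7 := HasSum.mul_eq h4 h2 hu
      rw [h7]
      exact hu
    rw [Fin.prod_univ_succ]
    exact ⟨(Fin.consEquiv fun _ => ι).summable_iff.1 (h3.congr fun p => by
        rw [Function.comp_apply, key]),
      (Fin.consEquiv fun _ => ι).hasSum_iff.1 (by simpa only [Function.comp_def, key] using h5)⟩

theorem hasSum_geometric_succ {𝕜 : Type*} [NormedField 𝕜] [CompleteSpace 𝕜] {y : 𝕜}
    (hy : ‖y‖ < 1) : HasSum (fun j : ℕ => y ^ (j + 1)) (y / (1 - y)) := by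
  simpa [pow_succ', div_eq_mul_inv] using (hasSum_geometric_of_norm_lt_one hy).mul_left y

theorem hasSum_prod_geometric_succ {𝕜 : Type*} [NormedField 𝕜] [CompleteSpace 𝕜] {k : ℕ}
    {y : Fin k → 𝕜} (hy : ∀ i, ‖y i‖ < 1) :
    HasSum (fun j : Fin k → ℕ => ∏ i, y i ^ (j i + 1)) (∏ i, y i / (1 - y i)) := by
  have h := (hasSum_prod_fin_of_summable_norm (f := fun i (j : ℕ) => y i ^ (j + 1)) fun i => by
    simp only [norm_pow]
    exact (hasSum_geometric_succ (by simpa using hy i)).summable).2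
  simpa only [(hasSum_geometric_succ (hy _)).tsum_eq] using h

end ProductOfSeries

/-! ### Decreasing tuples as finite sets -/

section Index

/-- The family `n₁ > ⋯ > n_k` underlying an index of the multiple zeta series. -/
def MZVIndex.entry {k : ℕ} (n : MZVIndex k) : Fin k → ℕ := n.1

theorem MZVIndex.strictAnti_entry {k : ℕ} (n : MZVIndex k) : StrictAnti n.entry := n.2.1

theorem MZVIndex.one_le_entry {k : ℕ} (n : MZVIndex k) (j : Fin k) : 1 ≤ n.entry j := n.2.2 j

theorem mzvTerm_eq {k : ℕ} (i : Fin k → ℕ) (n : MZVIndex k) :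
    mzvTerm i n = 1 / ∏ j, (n.entry j : ℝ) ^ i j := rfl

/-- The finite set `{n₁ - 1, …, n_k - 1}` attached to indices `n₁ > ⋯ > n_k ≥ 1`. -/
def mzvFinset (p : Σ k, MZVIndex k) : Finset ℕ :=
  Finset.univ.image fun j => p.2.entry j - 1

theorem MZVIndex.strictAnti_sub_one {k : ℕ} (n : MZVIndex k) :
    StrictAnti fun j => n.entry j - 1 := by
  intro a b hab
  have h1 := n.strictAnti_entry hab
  have h2 := n.one_le_entry b
  show n.entry b - 1 < n.entry a - 1
  omega

theorem prod_mzvFinset {M : Type*} [CommMonoid M] (f : ℕ → M) (p : Σ k, MZVIndex k) :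
    ∏ m ∈ mzvFinset p, f m = ∏ j, f (p.2.entry j - 1) :=
  Finset.prod_image fun _ _ _ _ h => p.2.strictAnti_sub_one.injective h

theorem mzvFinset_bijective : Function.Bijective mzvFinset := by
  constructor
  · rintro ⟨k, n⟩ ⟨l, m⟩ h
    have hk : ∀ p : Σ k, MZVIndex k, (mzvFinset p).card = p.1 := by
      intro p
      rw [mzvFinset, Finset.card_image_of_injective _ p.2.strictAnti_sub_one.injective]
      simp
    obtain rfl : k = l := by simpa only [hk] using congrArg Finset.card h
    have hr : (fun j => n.entry j - 1) = fun j => m.entry j - 1 := by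
      rw [← StrictAnti.range_inj n.strictAnti_sub_one m.strictAnti_sub_one]
      simpa [mzvFinset] using congrArg (fun s : Finset ℕ => (s : Set ℕ)) h
    have : n = m := by
      apply Subtype.ext
      funext j
      show n.entry j = m.entry j
      have h1 := congrFun hr j
      have h2 := n.one_le_entry j
      have h3 := m.one_le_entry j
      omega
    rw [this]
  · intro s
    -- `orderEmbOfFin` increases, so `rev` makes the tuple decrease; `+ 1` undoes the shift in
    -- `mzvFinset`.
    refine ⟨⟨s.card, ⟨fun j => s.orderEmbOfFin rfl j.rev + 1, fun a b hab => ?_, fun j => ?_⟩⟩, ?_⟩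
    · simpa using hab
    · exact Nat.le_add_left 1 _
    · ext x
      simp only [mzvFinset, MZVIndex.entry, Finset.mem_image, Finset.mem_univ, true_and, Nat.add_sub_cancel]
      have hx : x ∈ s ↔ x ∈ Set.range (s.orderEmbOfFin rfl) := by simp
      rw [hx]
      exact ⟨fun ⟨j, h⟩ => ⟨_, h⟩, fun ⟨j, h⟩ => ⟨j.rev, by simpa using h⟩⟩

/-- Families `n₁ > ⋯ > n_k ≥ 1` correspond to finite sets of natural numbers. -/
noncomputable def mzvIndexEquiv : (Σ k, MZVIndex k) ≃ Finset ℕ :=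
  Equiv.ofBijective mzvFinset mzvFinset_bijective

theorem summable_one_div_succ_sq : Summable fun m : ℕ => 1 / ((m : ℝ) + 1) ^ 2 := by
  simpa using (summable_nat_add_iff 1).2 (Real.summable_one_div_nat_pow.2 one_lt_two)

theorem MZVIndex.cast_sub_one {R : Type*} [Ring R] {k : ℕ} (n : MZVIndex k) (j : Fin k) :
    ((n.entry j - 1 : ℕ) : R) + 1 = n.entry j := by
  have := n.one_le_entry j
  rw [← Nat.cast_add_one, Nat.sub_add_cancel this]

/-- Each term is at most ∏ 1/n_j², and such products are summable over all finite sets because ∑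
1/m² converges. -/
theorem summable_mzvTerm {k : ℕ} {i : Fin k → ℕ} (hi : ∀ j, 2 ≤ i j) :
    Summable (mzvTerm i) := by
  have h := summable_finsetProd_of_summable_nonneg (f := fun m : ℕ => 1 / ((m : ℝ) + 1) ^ 2)
    (fun m => by positivity) summable_one_div_succ_sq
  have h2 := h.comp_injective (mzvFinset_bijective.injective.comp
    (sigma_mk_injective (i := k) (β := MZVIndex)))
  refine Summable.of_nonneg_of_le (fun n => by rw [mzvTerm_eq]; positivity) (fun n => ?_) h2
  simp only [Function.comp_def, prod_mzvFinset, n.cast_sub_one, mzvTerm_eq]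
  rw [one_div, ← Finset.prod_inv_distrib]
  refine Finset.prod_le_prod (fun j _ => by positivity) fun j _ => ?_
  rw [one_div]
  have : (1 : ℝ) ≤ n.entry j := by exact_mod_cast n.one_le_entry j
  gcongr
  exact hi j

end Index

/-! ### Euler's sine product without square roots -/

section SineProduct

/-- The coefficients of the entire function `z ↦ sin (π √z) / √z`. -/
noncomputable def sinSqrtCoeff (j : ℕ) : ℝ :=
  (-1) ^ j * Real.pi ^ (2 * j + 1) / (2 * j + 1).factorial

/-- The entire function `z ↦ sin (π √z) / √z`. -/
noncomputable def sinSqrtDiv (z : ℂ) : ℂ := ∑' j, (sinSqrtCoeff j : ℂ) * z ^ j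

theorem hasSum_sinSqrtCoeff_of_ne_zero {a : ℂ} (ha : a ≠ 0) :
    HasSum (fun j => (sinSqrtCoeff j : ℂ) * (a ^ 2) ^ j) (Complex.sin (Real.pi * a) / a) := by
  refine ((Complex.hasSum_sin (Real.pi * a)).div_const a).congr_fun fun j => ?_
  rw [sinSqrtCoeff]
  push_cast
  field_simp
  ring

theorem hasSum_sinSqrtDiv (z : ℂ) :
    HasSum (fun j => (sinSqrtCoeff j : ℂ) * z ^ j) (sinSqrtDiv z) := by
  refine Summable.hasSum ?_
  obtain ⟨a, rfl⟩ := IsAlgClosed.exists_pow_nat_eq z two_pos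
  rcases eq_or_ne a 0 with rfl | ha
  · refine (hasSum_single 0 fun j hj => ?_).summable
    simp [hj]
  · exact (hasSum_sinSqrtCoeff_of_ne_zero ha).summable

theorem sinSqrtDiv_zero : sinSqrtDiv 0 = Real.pi := by
  rw [sinSqrtDiv, tsum_eq_single 0 fun j hj => by simp [hj]]
  simp [sinSqrtCoeff]

theorem sin_pi_mul_eq (a : ℂ) : Complex.sin (Real.pi * a) = a * sinSqrtDiv (a ^ 2) := by
  rcases eq_or_ne a 0 with rfl | ha
  · simp
  · rw [(hasSum_sinSqrtDiv _).unique (hasSum_sinSqrtCoeff_of_ne_zero ha), mul_div_cancel₀ _ ha]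

theorem hasProd_sinSqrtDiv (z : ℂ) :
    HasProd (fun m : ℕ => 1 - z / ((m : ℂ) + 1) ^ 2) (sinSqrtDiv z / Real.pi) := by
  have hpi : (Real.pi : ℂ) ≠ 0 := by exact_mod_cast Real.pi_ne_zero
  obtain ⟨a, rfl⟩ := IsAlgClosed.exists_pow_nat_eq z two_pos
  rcases eq_or_ne a 0 with rfl | ha
  · simp [sinSqrtDiv_zero]
  · have h := ((multipliable_sineTerm a).hasProd_iff_tendsto_nat).2 (tendsto_euler_sin_prod' ha)
    rw [sin_pi_mul_eq] at h
    convert h using 1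
    · funext m
      simp [sineTerm, sub_eq_add_neg, neg_div]
    · field_simp

end SineProduct

/-! ### Expanding the infinite product -/

section Expansion

theorem norm_div_succ_sq_le (t : ℂ) (m : ℕ) : ‖t / ((m : ℂ) + 1) ^ 2‖ ≤ ‖t‖ := by
  rw [norm_div]
  refine div_le_self (norm_nonneg _) ?_
  rw [norm_pow, ← Nat.cast_add_one, Complex.norm_natCast]
  exact one_le_pow₀ (by simp)

theorem norm_div_succ_sq_eq (t : ℂ) (m : ℕ) :
    ‖t / ((m : ℂ) + 1) ^ 2‖ = ‖t‖ * (1 / ((m : ℝ) + 1) ^ 2) := by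
  rw [norm_div, norm_pow, ← Nat.cast_add_one, Complex.norm_natCast, mul_one_div]
  push_cast
  rfl

theorem summable_norm_mul_div_one_sub {t : ℂ} (ht : ‖t‖ < 1) (s : ℂ) :
    Summable fun m : ℕ => ‖s‖ * (‖t / ((m : ℂ) + 1) ^ 2‖ / (1 - ‖t / ((m : ℂ) + 1) ^ 2‖)) := by
  refine Summable.mul_left _ ?_
  refine Summable.of_nonneg_of_le (fun m => ?_) (fun m => ?_)
    ((summable_one_div_succ_sq.mul_left ‖t‖).div_const (1 - ‖t‖))
  · have := norm_div_succ_sq_le t m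
    exact div_nonneg (norm_nonneg _) (by linarith)
  · have := norm_div_succ_sq_le t m
    rw [← norm_div_succ_sq_eq]
    exact div_le_div_of_nonneg_left (norm_nonneg _) (by linarith) (by linarith)

/-- The ring is left general so that it serves both the complex terms and their real norms. -/
theorem pow_mul_prod_entry {R : Type*} [CommRing R] (f : ℂ → R) (s : R) (p : Σ k, MZVIndex k) :
    s ^ p.1 * ∏ i, f (p.2.entry i) = ∏ m ∈ mzvIndexEquiv p, s * f ((m : ℂ) + 1) := by
  have h : mzvIndexEquiv p = mzvFinset p := rfl
  rw [h, prod_mzvFinset]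
  simp only [p.2.cast_sub_one, Finset.prod_mul_distrib, Finset.prod_const, Finset.card_univ,
    Fintype.card_fin]

/-- The general term of the expansion of `∏ (1 + s ∑ⱼ (t / n²) ^ j)`. -/
noncomputable def expansionTerm (t s : ℂ) (x : Σ p : Σ k, MZVIndex k, Fin p.1 → ℕ) : ℂ :=
  s ^ x.1.1 * ∏ i, (t / (x.1.2.entry i : ℂ) ^ 2) ^ (x.2 i + 1)

theorem norm_div_entry_sq_lt {t : ℂ} (ht : ‖t‖ < 1) {k : ℕ} (n : MZVIndex k) (i : Fin k) :
    ‖t / (n.entry i : ℂ) ^ 2‖ < 1 := by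
  rw [← n.cast_sub_one i]
  exact (norm_div_succ_sq_le t _).trans_lt ht

theorem summable_norm_expansionTerm {t : ℂ} (ht : ‖t‖ < 1) (s : ℂ) :
    Summable fun x => ‖expansionTerm t s x‖ := by
  have h (p : Σ k, MZVIndex k) : HasSum (fun j => ‖expansionTerm t s ⟨p, j⟩‖)
      (‖s‖ ^ p.1 * ∏ i, (‖t / (p.2.entry i : ℂ) ^ 2‖ / (1 - ‖t / (p.2.entry i : ℂ) ^ 2‖))) := by
    simp only [expansionTerm, norm_mul, norm_pow, norm_prod]
    refine HasSum.mul_left _ ?_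
    exact hasSum_prod_geometric_succ fun i => by simpa using norm_div_entry_sq_lt ht p.2 i
  rw [summable_sigma_of_nonneg fun _ => norm_nonneg _]
  refine ⟨fun p => (h p).summable, ?_⟩
  simp only [(h _).tsum_eq]
  have h1 := summable_finsetProd_of_summable_norm (summable_norm_mul_div_one_sub ht s).norm
  rw [← mzvIndexEquiv.summable_iff] at h1
  exact h1.congr fun p => (pow_mul_prod_entry
    (fun z => ‖t / z ^ 2‖ / (1 - ‖t / z ^ 2‖)) ‖s‖ p).symm

theorem hasSum_expansionTerm {t : ℂ} (ht : ‖t‖ < 1) (s : ℂ) :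
    HasSum (expansionTerm t s)
      (∏' m : ℕ, (1 + s * (t / ((m : ℂ) + 1) ^ 2 / (1 - t / ((m : ℂ) + 1) ^ 2)))) := by
  have hs : HasSum (expansionTerm t s) (∑' x, expansionTerm t s x) :=
    (summable_norm_expansionTerm ht s).of_norm.hasSum
  generalize (∑' x, expansionTerm t s x) = A at hs
  have h (p : Σ k, MZVIndex k) : HasSum (fun j => expansionTerm t s ⟨p, j⟩)
      (s ^ p.1 * ∏ i, (t / (p.2.entry i : ℂ) ^ 2 / (1 - t / (p.2.entry i : ℂ) ^ 2))) :=
    HasSum.mul_left (s ^ p.1) (hasSum_prod_geometric_succ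
      (y := fun i => t / (p.2.entry i : ℂ) ^ 2) fun i => norm_div_entry_sq_lt ht p.2 i)
  have h1 := hs.sigma h
  have h2 : HasSum (fun S : Finset ℕ =>
      ∏ m ∈ S, s * (t / ((m : ℂ) + 1) ^ 2 / (1 - t / ((m : ℂ) + 1) ^ 2))) A := by
    rw [← mzvIndexEquiv.hasSum_iff]
    exact h1.congr_fun fun p => (pow_mul_prod_entry
      (fun z => t / z ^ 2 / (1 - t / z ^ 2)) s p).symm
  -- An infinite product of factors 1 + f m is the sum of ∏ f over finite sets.
  have h3 := tprod_one_add h2.summable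
  rw [h3, h2.tsum_eq]
  exact hs

theorem summable_mul_div_one_sub {t : ℂ} (ht : ‖t‖ < 1) (s : ℂ) :
    Summable fun m : ℕ => ‖s * (t / ((m : ℂ) + 1) ^ 2 / (1 - t / ((m : ℂ) + 1) ^ 2))‖ := by
  refine Summable.of_nonneg_of_le (fun _ => norm_nonneg _) (fun m => ?_)
    (summable_norm_mul_div_one_sub ht s)
  have h1 := norm_div_succ_sq_le t m
  have h2 := norm_sub_norm_le 1 (t / ((m : ℂ) + 1) ^ 2)
  rw [norm_one] at h2
  rw [norm_mul, norm_div]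
  refine mul_le_mul_of_nonneg_left ?_ (norm_nonneg _)
  exact div_le_div_of_nonneg_left (norm_nonneg _) (by linarith) h2

/-- Factor by factor, (1 + s·x/(1-x))(1-x) = 1 - (1-s)x. -/
theorem tprod_mul_sinSqrtDiv {t : ℂ} (ht : ‖t‖ < 1) (s : ℂ) :
    (∏' m : ℕ, (1 + s * (t / ((m : ℂ) + 1) ^ 2 / (1 - t / ((m : ℂ) + 1) ^ 2)))) * sinSqrtDiv t =
      sinSqrtDiv ((1 - s) * t) := by
  have hpi : (Real.pi : ℂ) ≠ 0 := by exact_mod_cast Real.pi_ne_zero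
  have h1 := (multipliable_one_add_of_summable (summable_mul_div_one_sub ht s)).hasProd
  have h0 (m : ℕ) : 1 - t / ((m : ℂ) + 1) ^ 2 ≠ 0 := fun h => by
    have := (norm_div_succ_sq_le t m).trans_lt ht
    rw [← sub_eq_zero.1 h] at this
    simp at this
  have h2 := (h1.mul (hasProd_sinSqrtDiv t)).congr_fun (g := fun m : ℕ =>
    1 - ((1 - s) * t) / ((m : ℂ) + 1) ^ 2) fun m => by
      rw [add_mul, mul_assoc, div_mul_cancel₀ _ (h0 m)]
      ring
  have h3 := h2.unique (hasProd_sinSqrtDiv ((1 - s) * t))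
  rwa [mul_div_assoc', div_left_inj' hpi] at h3

end Expansion

/-! ### Regrouping by weight and depth -/

section Regrouping

theorem expansionTerm_eq (t s : ℂ) {k : ℕ} (n : MZVIndex k) (j : Fin k → ℕ) :
    expansionTerm t s ⟨⟨k, n⟩, j⟩ =
      s ^ k * t ^ (∑ i, (j i + 1)) * (mzvTerm (fun i => 2 * (j i + 1)) n : ℂ) := by
  have h : expansionTerm t s ⟨⟨k, n⟩, j⟩ =
    s ^ k * ∏ i, (t / (n.entry i : ℂ) ^ 2) ^ (j i + 1) := rfl
  rw [h, mzvTerm_eq, mul_assoc]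
  push_cast
  simp only [div_pow, Finset.prod_div_distrib, Finset.prod_pow_eq_pow_sum, ← pow_mul, mul_one_div]

/-- Interchanging the indices and the exponents of the expansion. -/
def expansionEquiv : (Σ q : Σ k, Fin k → ℕ, MZVIndex q.1) ≃ Σ p : Σ k, MZVIndex k, Fin p.1 → ℕ where
  toFun x := ⟨⟨x.1.1, x.2⟩, x.1.2⟩
  invFun x := ⟨⟨x.1.1, x.2⟩, x.1.2⟩
  left_inv _ := rfl
  right_inv _ := rfl

theorem hasSum_exponents {t : ℂ} (ht : ‖t‖ < 1) (s : ℂ) :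
    HasSum (fun q : Σ k, Fin k → ℕ =>
        s ^ q.1 * t ^ (∑ i, (q.2 i + 1)) * (mzv (fun i => 2 * (q.2 i + 1)) : ℂ))
      (∏' m : ℕ, (1 + s * (t / ((m : ℂ) + 1) ^ 2 / (1 - t / ((m : ℂ) + 1) ^ 2)))) := by
  refine HasSum.sigma (expansionEquiv.hasSum_iff.2 (hasSum_expansionTerm ht s)) fun q => ?_
  have h : HasSum (mzvTerm fun i => 2 * (q.2 i + 1)) (mzv fun i => 2 * (q.2 i + 1)) :=
    (summable_mzvTerm fun i => by omega).hasSum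
  exact ((Complex.hasSum_ofReal.2 h).mul_left _).congr_fun fun n => expansionTerm_eq t s n q.2

theorem mem_evenArguments {w k : ℕ} {i : Fin k → ℕ} :
    i ∈ evenArguments w k ↔ ∑ j, i j = w ∧ ∀ j, 0 < i j ∧ Even (i j) := by
  simp [evenArguments]

theorem preimage_weight_depth (N k : ℕ) :
    (fun q : Σ k, Fin k → ℕ => (∑ i, (q.2 i + 1), q.1)) ⁻¹' {(N, k)} =
      ((evenArguments (2 * N) k).image fun i => (⟨k, fun l => i l / 2 - 1⟩ : Σ k, Fin k → ℕ) :
        Finset (Σ k, Fin k → ℕ)) := by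
  ext ⟨l, j⟩
  simp only [Set.mem_preimage, Set.mem_singleton_iff, Prod.mk.injEq, Finset.coe_image,
    Set.mem_image, Finset.mem_coe, mem_evenArguments]
  constructor
  · rintro ⟨h, rfl⟩
    refine ⟨fun i => 2 * (j i + 1), ⟨?_, fun i => ⟨by positivity, even_two_mul _⟩⟩, ?_⟩
    · rw [← Finset.mul_sum, h]
    · congr 1
      funext i
      show 2 * (j i + 1) / 2 - 1 = j i
      omega
  · rintro ⟨i, ⟨h1, h2⟩, h3⟩
    obtain ⟨rfl, h3⟩ := Sigma.mk.inj_iff.1 h3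
    obtain rfl := eq_of_heq h3
    refine ⟨?_, rfl⟩
    show ∑ l, (i l / 2 - 1 + 1) = N
    have h4 : ∀ l, 2 * (i l / 2 - 1 + 1) = i l := fun l => by
      have := (h2 l).1
      obtain ⟨r, hr⟩ := (h2 l).2
      omega
    have h5 : 2 * ∑ l, (i l / 2 - 1 + 1) = 2 * N := by
      rw [Finset.mul_sum, ← h1]
      exact Finset.sum_congr rfl fun l _ => h4 l
    omega

theorem hasSum_evenMZVSum {t : ℂ} (ht : ‖t‖ < 1) (s : ℂ) :
    HasSum (fun p : ℕ × ℕ => (evenMZVSum (2 * p.1) p.2 : ℂ) * t ^ p.1 * s ^ p.2)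
      (∏' m : ℕ, (1 + s * (t / ((m : ℂ) + 1) ^ 2 / (1 - t / ((m : ℂ) + 1) ^ 2)))) := by
  refine ((hasSum_exponents ht s).tsum_fiberwise
    fun q => (∑ i, (q.2 i + 1), q.1)).congr_fun fun p => ?_
  obtain ⟨N, k⟩ := p
  have hev : ∀ i ∈ evenArguments (2 * N) k, ∀ l, 2 * (i l / 2 - 1 + 1) = i l := fun i hi l => by
    have h2 := (mem_evenArguments.1 hi).2 l
    obtain ⟨r, hr⟩ := h2.2
    omega
  rw [preimage_weight_depth]
  refine Eq.trans ?_ (Finset.tsum_subtype' _ fun q : Σ k, Fin k → ℕ =>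
    s ^ q.1 * t ^ (∑ i, (q.2 i + 1)) * (mzv (fun i => 2 * (q.2 i + 1)) : ℂ)).symm
  rw [Finset.sum_image]
  · rw [evenMZVSum]
    push_cast
    rw [Finset.sum_mul, Finset.sum_mul]
    refine Finset.sum_congr rfl fun i hi => ?_
    have h1 : ∑ l, (i l / 2 - 1 + 1) = N := by
      have : 2 * ∑ l, (i l / 2 - 1 + 1) = 2 * N := by
        rw [Finset.mul_sum, ← (mem_evenArguments.1 hi).1]
        exact Finset.sum_congr rfl fun l _ => hev i hi l
      omega
    have h2 : (fun l => 2 * (i l / 2 - 1 + 1)) = i := funext (hev i hi)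
    simp only [h1, h2]
    ring
  · intro a ha b hb hab
    have h := eq_of_heq (Sigma.mk.inj_iff.1 hab).2
    funext l
    have h1 := congrFun h l
    have h2 := hev a ha l
    have h3 := hev b hb l
    omega

/-- The empty tuple supplies the leading 1 of F, so the sum can run over all of ℕ × ℕ. -/
theorem evenMZVSum_zero_zero : evenMZVSum 0 0 = 1 := by
  have h : evenArguments 0 0 = {![]} := by
    ext i
    simp [mem_evenArguments, Subsingleton.elim i ![]]
  have : Unique (MZVIndex 0) :=
    ⟨⟨⟨![], fun a => a.elim0, fun a => a.elim0⟩⟩, fun n => Subtype.ext (Subsingleton.elim _ _)⟩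
  rw [evenMZVSum, h, Finset.sum_singleton, mzv, tsum_eq_single default fun n hn =>
    absurd (Subsingleton.elim _ _) hn]
  simp [mzvTerm_eq]

theorem evenMZVSum_eq_zero {n k : ℕ} (h : ¬(1 ≤ k ∧ k ≤ n)) (h0 : ¬(n = 0 ∧ k = 0)) :
    evenMZVSum (2 * n) k = 0 := by
  rw [evenMZVSum]
  refine Finset.sum_eq_zero fun i hi => absurd ?_ h
  obtain ⟨h1, h2⟩ := mem_evenArguments.1 hi
  have h3 : 2 * k ≤ ∑ j, i j := by
    have : ∑ _j : Fin k, 2 ≤ ∑ j, i j := Finset.sum_le_sum fun j _ => by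
      obtain ⟨r, hr⟩ := (h2 j).2
      have := (h2 j).1
      omega
    simpa [mul_comm] using this
  have h4 : k = 0 → n = 0 := by
    rintro rfl
    simpa using h1.symm
  omega

theorem summable_genTerm {t : ℂ} (ht : ‖t‖ < 1) (s : ℂ) : Summable (genTerm t s) :=
  (hasSum_evenMZVSum ht s).summable.comp_injective
    (Subtype.val_injective (p := fun p : ℕ × ℕ => 1 ≤ p.2 ∧ p.2 ≤ p.1))

theorem hasSum_genFun {t : ℂ} (ht : ‖t‖ < 1) (s : ℂ) :
    HasSum (fun p : ℕ × ℕ => (evenMZVSum (2 * p.1) p.2 : ℂ) * t ^ p.1 * s ^ p.2) (genFun t s) := by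
  have h1 : HasSum (genTerm t s) (∑' p, genTerm t s p) := (summable_genTerm ht s).hasSum
  have h2 := (hasSum_subtype_iff_indicator
    (f := fun p : ℕ × ℕ => (evenMZVSum (2 * p.1) p.2 : ℂ) * t ^ p.1 * s ^ p.2)
    (s := {p : ℕ × ℕ | 1 ≤ p.2 ∧ p.2 ≤ p.1})).1 h1
  have h3 := (hasSum_ite_eq ((0, 0) : ℕ × ℕ) (1 : ℂ)).add h2
  refine h3.congr_fun fun p => ?_
  obtain ⟨n, k⟩ := p
  by_cases h : 1 ≤ k ∧ k ≤ n
  · have : ¬ (n = 0 ∧ k = 0) := by omega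
    simp [Set.indicator, h, this]
  · by_cases h0 : n = 0 ∧ k = 0
    · obtain ⟨rfl, rfl⟩ := h0
      simp [Set.indicator, evenMZVSum_zero_zero]
    · simp [Set.indicator, h, h0, evenMZVSum_eq_zero h h0]

theorem genFun_mul_sinSqrtDiv {t : ℂ} (ht : ‖t‖ < 1) (s : ℂ) :
    genFun t s * sinSqrtDiv t = sinSqrtDiv ((1 - s) * t) := by
  rw [(hasSum_genFun ht s).unique (hasSum_evenMZVSum ht s), tprod_mul_sinSqrtDiv ht]

end Regrouping

/-! ### The formal power series identity -/

section FormalIdentity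

theorem genSeries_eq :
    genSeries = PowerSeries.mk fun n => PowerSeries.mk fun k => evenMZVSum (2 * n) k := by
  ext n k
  rw [genSeries]
  by_cases h : 1 ≤ k ∧ k ≤ n
  · have : ¬ n = 0 := by omega
    simp [h, coeff_one, this]
  · by_cases h0 : n = 0 ∧ k = 0
    · obtain ⟨rfl, rfl⟩ := h0
      simp [evenMZVSum_zero_zero]
    · rw [coeff_mk, coeff_mk, evenMZVSum_eq_zero h h0, map_add, map_add, coeff_mk, coeff_mk, if_neg h,
        coeff_one]
      split_ifs with hn
      · have : k ≠ 0 := fun hk => h0 ⟨hn, hk⟩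
        simp [coeff_one, this]
      · simp

/-- The coefficient of `tⁿ` in the generating function, a polynomial in `s`. -/
noncomputable def genPolynomial (n : ℕ) : Polynomial ℝ :=
  ∑ k ∈ Finset.range (n + 1), Polynomial.monomial k (evenMZVSum (2 * n) k)

theorem coe_genPolynomial (n : ℕ) :
    (genPolynomial n : ℝ⟦X⟧) = PowerSeries.mk fun k => evenMZVSum (2 * n) k := by
  ext k
  rw [Polynomial.coeff_coe, coeff_mk, genPolynomial, Polynomial.finsetSum_coeff]
  simp only [Polynomial.coeff_monomial, Finset.sum_ite_eq', Finset.mem_range]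
  split_ifs with h
  · rfl
  · exact (evenMZVSum_eq_zero (by omega) (by omega)).symm

theorem hasSum_genPolynomial {t : ℂ} (ht : ‖t‖ < 1) (s : ℝ) :
    HasSum (fun n => (((genPolynomial n).eval s : ℝ) : ℂ) * t ^ n) (genFun t s) := by
  refine (hasSum_genFun ht s).prod_fiberwise fun n => ?_
  have h : (((genPolynomial n).eval s : ℝ) : ℂ) * t ^ n =
      ∑ k ∈ Finset.range (n + 1), (evenMZVSum (2 * n) k : ℂ) * t ^ n * (s : ℂ) ^ k := by
    rw [genPolynomial, Polynomial.eval_finsetSum]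
    push_cast
    rw [Finset.sum_mul]
    refine Finset.sum_congr rfl fun k _ => ?_
    rw [Polynomial.eval_monomial]
    push_cast
    ring
  rw [h]
  refine hasSum_sum_of_ne_finset_zero fun k hk => ?_
  rw [Finset.mem_range] at hk
  simp [evenMZVSum_eq_zero (n := n) (k := k) (by omega) (by omega)]

theorem eq_of_hasSum_pow_eq {a b : ℕ → ℂ} {f : ℂ → ℂ}
    (ha : ∀ t : ℂ, ‖t‖ < 1 → HasSum (fun n => a n * t ^ n) (f t))
    (hb : ∀ t : ℂ, ‖t‖ < 1 → HasSum (fun n => b n * t ^ n) (f t)) : a = b := by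
  have key (c : ℕ → ℂ) (hc : ∀ t : ℂ, ‖t‖ < 1 → HasSum (fun n => c n * t ^ n) (f t)) :
      HasFPowerSeriesAt f (FormalMultilinearSeries.ofScalars ℂ c) 0 := by
    rw [hasFPowerSeriesAt_iff]
    filter_upwards [Metric.ball_mem_nhds (0 : ℂ) one_pos] with t ht
    rw [mem_ball_zero_iff] at ht
    simpa [FormalMultilinearSeries.coeff_ofScalars, mul_comm] using hc t ht
  exact FormalMultilinearSeries.ofScalars_series_injective (𝕜 := ℂ) ℂ
    ((key a ha).eq_formalMultilinearSeries (key b hb))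

/-- At each real s this is the Cauchy product form of `genFun_mul_sinSqrtDiv`; polynomials agreeing
at all reals are equal. -/
theorem sum_antidiagonal_genPolynomial (m : ℕ) :
    ∑ p ∈ Finset.HasAntidiagonal.antidiagonal m, genPolynomial p.1 * Polynomial.C (sinSqrtCoeff p.2) =
      Polynomial.C (sinSqrtCoeff m) * (1 - Polynomial.X) ^ m := by
  refine Polynomial.funext fun s => ?_
  have h := eq_of_hasSum_pow_eq (f := fun t => sinSqrtDiv ((1 - (s : ℂ)) * t))
    (a := fun m => ∑ p ∈ Finset.HasAntidiagonal.antidiagonal m,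
      (((genPolynomial p.1).eval s : ℝ) : ℂ) * (sinSqrtCoeff p.2 : ℂ))
    (b := fun m => (sinSqrtCoeff m : ℂ) * (1 - (s : ℂ)) ^ m)
    (fun t ht => by
      have h1 := hasSum_genPolynomial ht s
      have h2 := hasSum_sinSqrtDiv t
      have h3 := summable_norm_sum_mul_antidiagonal_of_summable_norm h1.summable.norm
        h2.summable.norm
      have h4 := tsum_mul_tsum_eq_tsum_sum_antidiagonal_of_summable_norm h1.summable.norm
        h2.summable.norm
      rw [h1.tsum_eq, h2.tsum_eq, genFun_mul_sinSqrtDiv ht] at h4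
      simp only [h4]
      refine h3.of_norm.hasSum.congr_fun fun n => ?_
      rw [Finset.sum_mul]
      refine Finset.sum_congr rfl fun p hp => ?_
      rw [← Finset.HasAntidiagonal.mem_antidiagonal.1 hp, pow_add]
      ring)
    (fun t _ => (hasSum_sinSqrtDiv ((1 - (s : ℂ)) * t)).congr_fun fun n => by
      rw [mul_pow, mul_assoc])
  have hm := congrFun h m
  rw [Polynomial.eval_finsetSum]
  simp only [Polynomial.eval_mul, Polynomial.eval_C, Polynomial.eval_pow, Polynomial.eval_sub,
    Polynomial.eval_one, Polynomial.eval_X]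
  exact_mod_cast hm

theorem genSeries_mul :
    genSeries * PowerSeries.mk (fun m => C (sinSqrtCoeff m)) =
      PowerSeries.mk fun m => C (sinSqrtCoeff m) * (1 - X) ^ m := by
  ext1 m
  rw [coeff_mul, coeff_mk, genSeries_eq]
  simp only [coeff_mk, ← coe_genPolynomial]
  have h := congrArg (Polynomial.coeToPowerSeries.ringHom (R := ℝ))
    (sum_antidiagonal_genPolynomial m)
  simpa [map_sum] using h

/-- Sine is odd: u times a series in u², with only odd powers of c. -/
theorem sinPiMul_eq (c : ℝ⟦X⟧) :
    sinPiMul c = X * PowerSeries.expand 2 two_ne_zero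
      (PowerSeries.mk fun m => C (sinSqrtCoeff m) * c ^ (2 * m + 1)) := by
  ext1 n
  rw [sinPiMul, coeff_rescale]
  rcases n with _ | n
  · simp [PowerSeries.sin]
  · rw [coeff_succ_X_mul, PowerSeries.coeff_expand, PowerSeries.sin, coeff_mk]
    rcases Nat.even_or_odd' n with ⟨m, rfl | rfl⟩
    · have h : ¬ Even (2 * m + 1) := by simp
      rw [if_neg h, if_pos (dvd_mul_right 2 m), Nat.mul_div_cancel_left _ two_pos, coeff_mk]
      have h2 : (2 * m + 1) / 2 = m := by omega
      rw [h2, PowerSeries.algebraMap_apply, mul_pow, ← map_pow, mul_right_comm, ← map_mul]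
      congr 2
      simp [sinSqrtCoeff]
      ring
    · have h : Even (2 * m + 1 + 1) := by simp [parity_simps]
      rw [if_pos h, if_neg (by omega), mul_zero]

theorem sinPiMul_sqrtOneSub :
    sinPiMul sqrtOneSub = C sqrtOneSub * (X * PowerSeries.expand 2 two_ne_zero
      (PowerSeries.mk fun m => C (sinSqrtCoeff m) * (1 - X) ^ m)) := by
  have h : (PowerSeries.mk fun m => C (sinSqrtCoeff m) * sqrtOneSub ^ (2 * m + 1)) =
      C sqrtOneSub * PowerSeries.mk fun m => C (sinSqrtCoeff m) * (1 - X) ^ m := by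
    ext1 m
    rw [coeff_C_mul, coeff_mk, coeff_mk, pow_succ, pow_mul, sqrtOneSub_sq]
    ring
  rw [sinPiMul_eq, h, map_mul, PowerSeries.expand_C]
  ring

theorem sinPiMul_one :
    sinPiMul 1 = X * PowerSeries.expand 2 two_ne_zero
      (PowerSeries.mk fun m => C (sinSqrtCoeff m)) := by
  simp [sinPiMul_eq]

theorem expand_genSeries_mul :
    PowerSeries.expand 2 two_ne_zero genSeries * (C sqrtOneSub * sinPiMul 1) =
      sinPiMul sqrtOneSub := by
  rw [sinPiMul_sqrtOneSub, sinPiMul_one, ← genSeries_mul, map_mul]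
  ring

theorem C_sqrtOneSub_mul_sinPiMul_ne_zero : C sqrtOneSub * sinPiMul 1 ≠ 0 := by
  refine mul_ne_zero ?_ ?_
  · intro h
    have h1 : sqrtOneSub = 0 := C_injective (by simpa using h)
    -- The square 1 - s has constant term 1, so the root cannot vanish.
    have h2 := congrArg (coeff 0) sqrtOneSub_sq
    simp [h1] at h2
  · intro h
    -- The coefficient of u in sin(πu) is π.
    have h1 := congrArg (coeff 0) (congrArg (coeff 1) h)
    rw [sinPiMul_one] at h1
    have h2 := PowerSeries.coeff_succ_X_mul 0 (PowerSeries.expand 2 two_ne_zero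
      (PowerSeries.mk fun m => (C (sinSqrtCoeff m) : ℝ⟦X⟧)))
    rw [zero_add] at h2
    rw [h2] at h1
    simp [PowerSeries.coeff_expand, sinSqrtCoeff, Real.pi_ne_zero] at h1

end FormalIdentity

/-! ### The analytic identity and the conclusion -/

theorem sin_pi_mul_ne_zero_of_norm_lt_one {a : ℂ} (ha : ‖a‖ < 1) (h0 : a ≠ 0) :
    Complex.sin (Real.pi * a) ≠ 0 := by
  refine sin_pi_mul_ne_zero fun ⟨n, hn⟩ => ?_
  rw [← hn, Complex.norm_intCast] at ha
  have h1 : |n| < 1 := by exact_mod_cast ha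
  rw [Int.abs_lt_one_iff] at h1
  exact h0 (by rw [← hn, h1, Int.cast_zero])

theorem genFun_eq_sin_div_sin {t s a b : ℂ} (ht : ‖t‖ < 1) (h0 : t ≠ 0) (hs : s ≠ 1)
    (ha : a ^ 2 = t) (hb : b ^ 2 = 1 - s) :
    b * Complex.sin (Real.pi * a) ≠ 0 ∧
      genFun t s = Complex.sin (Real.pi * b * a) / (b * Complex.sin (Real.pi * a)) := by
  have ha0 : a ≠ 0 := by
    rintro rfl
    exact h0 (by simp [← ha])
  have hb0 : b ≠ 0 := by
    rintro rfl
    exact hs (by linear_combination hb)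
  have ha1 : ‖a‖ < 1 := by
    rw [← ha, norm_pow] at ht
    exact (pow_lt_one_iff_of_nonneg (norm_nonneg _) two_ne_zero).1 ht
  have hne := mul_ne_zero hb0 (sin_pi_mul_ne_zero_of_norm_lt_one ha1 ha0)
  refine ⟨hne, ?_⟩
  rw [eq_div_iff hne, mul_assoc, sin_pi_mul_eq, sin_pi_mul_eq, mul_pow, ha, hb,
    ← genFun_mul_sinSqrtDiv ht]
  ring

/-- The three parts: the multiple zeta series occurring in the coefficients converge; the
identity holds in the formal power series domain `ℝ⟦s⟧⟦u⟧`, where `t = u ^ 2`, so `u = √t`;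
and it holds, with convergence, for complex `|t| < 1`, for every choice `a` of `√t` and `b` of
`√(1 - s)`, wherever the right hand side has a nonzero denominator. -/
theorem theorem2 :
    (∀ (k : ℕ) (i : Fin k → ℕ), (∀ j, 0 < i j ∧ Even (i j)) → Summable (mzvTerm i)) ∧
    (C sqrtOneSub * sinPiMul 1 ≠ 0 ∧
      PowerSeries.expand 2 two_ne_zero genSeries * (C sqrtOneSub * sinPiMul 1) =
        sinPiMul sqrtOneSub) ∧
    (∀ t s : ℂ, ‖t‖ < 1 → Summable (genTerm t s)) ∧
    (∀ t s a b : ℂ, ‖t‖ < 1 → t ≠ 0 → s ≠ 1 → a ^ 2 = t → b ^ 2 = 1 - s →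
      b * Complex.sin (Real.pi * a) ≠ 0 ∧
      genFun t s = Complex.sin (Real.pi * b * a) / (b * Complex.sin (Real.pi * a))) := by
  exact ⟨fun _ _ h => summable_mzvTerm fun j => Nat.le_of_dvd (h j).1 (h j).2.two_dvd,
    ⟨C_sqrtOneSub_mul_sinPiMul_ne_zero, expand_genSeries_mul⟩,
    fun _ s ht => summable_genTerm ht s,
    fun _ _ _ _ ht h0 hs ha hb => genFun_eq_sin_div_sin ht h0 hs ha hb⟩
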